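/- A (finite) Kripke game consists of a finite set $P$ of players, a finite set $W$ of worlds and, for each player $p\in P$, a finite non-empty set $S_p$ of strategies, an equivalence relation $\equiv_p$ on $W$, and, for each world $w\in W$, a payoff function $u_p^w:\prod_{q\in P}S_q\to\mathbb R$. Write $[w]_p=\{v\in W : v\equiv_p w\}$ and let $[W]_p$ be the set of $\equiv_p$-classes. A pure strategy of player $p$ is a map $[W]_p\to S_p$; a mixed strategy of $p$ is a probability distribution on the set $S_p^{[W]_p}$ of her pure strategies; a play is a product distribution $\sigma=\prod_{p\in P}\sigma_p$, where each $\sigma_p$ is a mixed strategy of player $p$. If $X=(X_p)_{p\in P}$ has law $\sigma$ (so that the $X_p$ are independent with laws $\sigma_p$), put $X(v)=(X_p([v]_p))_{p\in P}\in\prod_{p\in P}S_p$ for $v\in W$, and define the payoff of player $p$ in world $w$ by \[ \mathrm{pay}_p^w(\sigma)=\min_{v\in[w]_p}\mathbb E\big[u_p^v(X(v))\big]. \] A play $\sigma$ is an equilibrium if for every player $p\in P$, every world $w\in W$ and every mixed strategy $\sigma_p'$ of $p$ one has $\mathrm{pay}_p^w(\sigma)\ge\mathrm{pay}_p^w(\sigma')$,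 where $\sigma'$ is obtained from $\sigma$ by replacing the factor $\sigma_p$ by $\sigma_p'$. Theorem. Every Kripke game has an equilibrium play. -/

import Mathlib

universe u v w

/-- A Kripke game with players `P` on worlds `W`. -/
structure KripkeGame (P : Type u) (W : Type v) where
  /-- The set of strategies of each player (the same in all worlds). -/
  Strategy : P → Type w
  /-- Strategy sets are finite. -/
  finite_strategy : ∀ p, Finite (Strategy p)
  /-- The equivalence relation of each player on the worlds. -/
  equiv : P → Setoid W
  /-- The payoff of player `p` in world `x`. -/
  utility : (p : P) → (x : W) → ((q : P) → Strategy q) → ℝ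

namespace KripkeGame

variable {P : Type u} {W : Type v}

/-- The set of equivalence classes of worlds for player `p`. -/
abbrev WorldClass (G : KripkeGame.{u, v, w} P W) (p : P) : Type v :=
  Quotient (G.equiv p)

/-- The equivalence class of the world `x` for player `p`. -/
abbrev classOf (G : KripkeGame.{u, v, w} P W) (p : P) (x : W) : G.WorldClass p :=
  Quotient.mk (G.equiv p) x

/-- A pure strategy of player `p`: a map from her equivalence classes to her strategies. -/
abbrev PureStrategy (G : KripkeGame.{u, v, w} P W) (p : P) : Type (max v w) :=
  G.WorldClass p → G.Strategy p

noncomputable instance pureStrategyFintype [Finite W] (G : KripkeGame.{u, v, w} P W) (p : P) :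
    Fintype (G.PureStrategy p) :=
  haveI := G.finite_strategy p
  Fintype.ofFinite _

/-- A mixed strategy of player `p`: a probability distribution over her pure strategies. -/
abbrev MixedStrategy [Finite W] (G : KripkeGame.{u, v, w} P W) (p : P) : Type (max v w) :=
  stdSimplex ℝ (G.PureStrategy p)

/-- A play, given by its factors: one mixed strategy for each player. The product distribution
that it determines is `KripkeGame.law`. -/
abbrev Play [Finite W] (G : KripkeGame.{u, v, w} P W) : Type (max u v w) :=
  (p : P) → G.MixedStrategy p

/-- A profile of pure strategies, i.e. a value of a play instance. -/
abbrev PureProfile (G : KripkeGame.{u, v, w} P W) : Type (max u v w) :=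
  (p : P) → G.PureStrategy p

/-- The specialization of a profile of pure strategies to the world `x`. -/
def specialize (G : KripkeGame.{u, v, w} P W) (s : G.PureProfile) (x : W) :
    (p : P) → G.Strategy p :=
  fun p => s p (G.classOf p x)

/-- The product distribution of a play: the players draw their pure strategies
independently. -/
noncomputable def law [Fintype P] [DecidableEq P] [Finite W] (G : KripkeGame.{u, v, w} P W)
    (σ : G.Play) : stdSimplex ℝ G.PureProfile :=
  ⟨fun s => ∏ p, (σ p : G.PureStrategy p → ℝ) (s p),
    fun s => Finset.prod_nonneg fun p _ => (σ p).2.1 (s p), by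
      rw [← Fintype.prod_sum (fun p t => (σ p : G.PureStrategy p → ℝ) t)]
      exact Finset.prod_eq_one fun p _ => (σ p).2.2⟩

/-- The expected payoff of player `p` computed in the world `x`, when the profile of pure
strategies is drawn from the law of `σ` and specialized to `x`. -/
noncomputable def expectedPayoff [Fintype P] [DecidableEq P] [Finite W]
    (G : KripkeGame.{u, v, w} P W) (σ : G.Play) (p : P) (x : W) : ℝ :=
  ∑ s : G.PureProfile, (G.law σ : G.PureProfile → ℝ) s * G.utility p x (G.specialize s x)

open Classical in
/-- The worlds in the equivalence class of `x` for player `p`, as a finite set. -/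
noncomputable def classFinset [Fintype W] (G : KripkeGame.{u, v, w} P W) (p : P) (x : W) :
    Finset W :=
  Finset.univ.filter fun y => (G.equiv p) y x

theorem classFinset_nonempty [Fintype W] (G : KripkeGame.{u, v, w} P W) (p : P) (x : W) :
    (G.classFinset p x).Nonempty :=
  ⟨x, by simp [classFinset]⟩

/-- The payoff of player `p` in the world `x`: the minimum of her expected payoffs over the
worlds that she cannot distinguish from `x`. -/
noncomputable def payoff [Fintype P] [DecidableEq P] [Fintype W]
    (G : KripkeGame.{u, v, w} P W) (σ : G.Play) (p : P) (x : W) : ℝ :=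
  (G.classFinset p x).inf' (G.classFinset_nonempty p x) fun y => G.expectedPayoff σ p y

/-- Player `p` tolerates `σ` if in no world can she gain by changing her own mixed strategy. -/
def Tolerates [Fintype P] [DecidableEq P] [Fintype W]
    (G : KripkeGame.{u, v, w} P W) (p : P) (σ : G.Play) : Prop :=
  ∀ (x : W) (τ : G.MixedStrategy p), G.payoff (Function.update σ p τ) p x ≤ G.payoff σ p x

/-- An equilibrium is a play that every player tolerates. -/
def IsEquilibrium [Fintype P] [DecidableEq P] [Fintype W]
    (G : KripkeGame.{u, v, w} P W) (σ : G.Play) : Prop :=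
  ∀ p : P, G.Tolerates p σ

end KripkeGame

/-! Let Φ(σ, τ) be the sum, over all players p and worlds x, of the payoff of p in x when p alone
deviates from σ to her factor of τ (`deviationPayoff`). Expected payoffs are multilinear in the
factors and a minimum of linear functions is concave, so Φ is jointly continuous, and concave in τ.
Ky Fan's inequality (`exists_forall_le_diag`) yields σ with Φ(σ, τ) ≤ Φ(σ, σ) for all τ, so no
player can increase the sum of her payoffs over the worlds. An equilibrium asks for this in each
world separately. The gap closes because a player's expected payoff in a world sees her own strategy
only through its value at one class: a gain in one class can be kept while the other classes are
left alone (`exists_glued_strategy`), and it would raise the sum.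

Ky Fan's inequality reduces by compactness to finitely many test points. There it follows from a
covering property of the simplex: some point lies in every member of a closed cover that is indexed
by its support. The discrete form of this on a fine grid is an instance of Scarf's lemma, which is
proved by a parity count of dominant sets. -/

/-- A surjection between finite sets whose sizes differ by one can be restricted to the complement
of a point, staying surjective, for exactly two points. -/
theorem Finset.card_filter_image_erase_eq_two {α β : Type*} [DecidableEq α] [DecidableEq β]
    {s : Finset α} {t : Finset β} {f : α → β} (himg : s.image f = t) (hcard : s.card = t.card + 1) :
    (s.filter fun a => (s.erase a).image f = t).card = 2 := by
  obtain ⟨a, ha, b, hb, hab, hf⟩ := Finset.exists_ne_map_eq_of_card_lt_of_maps_to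
    (s := s) (t := t) (f := f) (by omega)
    (fun x hx => by rw [← himg]; exact Finset.mem_image_of_mem f hx)
  have key : ∀ a ∈ s, ∀ b ∈ s, a ≠ b → f a = f b → (s.erase a).image f = t := by
    intro a ha b hb hab hf
    rw [← himg]
    ext y
    simp only [Finset.mem_image, Finset.mem_erase]
    constructor
    · rintro ⟨x, ⟨-, hx⟩, rfl⟩
      exact ⟨x, hx, rfl⟩
    · rintro ⟨x, hx, rfl⟩
      by_cases hxa : x = a
      · exact ⟨b, ⟨hab.symm, hb⟩, by rw [hxa, hf]⟩
      · exact ⟨x, ⟨hxa, hx⟩, rfl⟩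
  have hea := key a ha b hb hab hf
  have hinj : Set.InjOn f (s.erase a) := by
    rw [← Finset.card_image_iff, hea, Finset.card_erase_of_mem ha]
    omega
  have : (s.filter fun a => (s.erase a).image f = t) = {a, b} := by
    ext x
    simp only [Finset.mem_filter, Finset.mem_insert, Finset.mem_singleton]
    constructor
    · rintro ⟨hx, hxe⟩
      by_contra! hne
      have : f x ∈ (s.erase x).image f := by
        rw [hxe, ← himg]; exact Finset.mem_image_of_mem f hx
      obtain ⟨y, hy, hyx⟩ := Finset.mem_image.1 this
      obtain ⟨hyne, hys⟩ := Finset.mem_erase.1 hy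
      by_cases hya : y = a
      · refine hne.2 (hinj ?_ ?_ ?_)
        · simp [hx, hne.1]
        · simp [hb, hab.symm]
        · rw [← hyx, hya, hf]
      · refine hyne (hinj ?_ ?_ hyx)
        · simp [hys, hya]
        · simp [hx, hne.1]
    · rintro (rfl | rfl)
      · exact ⟨ha, hea⟩
      · exact ⟨hb, key _ hb _ ha hab.symm hf.symm⟩
  rw [this, Finset.card_pair hab]

/-! ### Scarf's combinatorial lemma -/

section Scarf

variable {T ι : Type*}

/-- Given a family `k` of rankings of `T`, a finite set `S ⊆ T ⊕ ι` is dominant if every `y : T` is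
ranked below all elements of `T` in `S` by some ranking whose index is not in `S`. -/
def Dominant (k : ι → T → ℕ) (S : Finset (T ⊕ ι)) : Prop :=
  ∀ y, ∃ i, Sum.inr i ∉ S ∧ ∀ x, Sum.inl x ∈ S → k i y ≤ k i x

theorem Dominant.mono {k : ι → T → ℕ} {S R : Finset (T ⊕ ι)} (h : Dominant k R) (hSR : S ⊆ R) :
    Dominant k S := fun y =>
  let ⟨i, hi, hx⟩ := h y
  ⟨i, fun hS => hi (hSR hS), fun x hxS => hx x (hSR hxS)⟩

variable [Fintype T] [Fintype ι] [DecidableEq T] [DecidableEq ι]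

/-- A dominant set with one element less than there are rankings, and which meets `T`, has exactly
two dominant extensions by one element. -/
theorem Dominant.card_extensions_eq_two {k : ι → T → ℕ} (hk : ∀ i, Function.Injective (k i))
    {S : Finset (T ⊕ ι)} (hS : Dominant k S) (hcard : S.card + 1 = Fintype.card ι)
    {x₀ : T} (hx₀ : Sum.inl x₀ ∈ S) [DecidablePred fun z => z ∉ S ∧ Dominant k (insert z S)] :
    (Finset.univ.filter fun z => z ∉ S ∧ Dominant k (insert z S)).card = 2 := by
  classical
  have hmin : ∀ i, ∃ x, Sum.inl x ∈ S ∧ ∀ x', Sum.inl x' ∈ S → k i x ≤ k i x' := by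
    intro i
    obtain ⟨x, hx, hmin⟩ := Finset.exists_min_image
      (Finset.univ.filter fun x : T => (Sum.inl x : T ⊕ ι) ∈ S) (k i) ⟨x₀, by simpa using hx₀⟩
    exact ⟨x, by simpa using hx, fun x' hx' => hmin x' (by simpa using hx')⟩
  choose a haS hale using hmin
  have ha_eq : ∀ i x, Sum.inl x ∈ S → (∀ x', Sum.inl x' ∈ S → k i x ≤ k i x') → a i = x :=
    fun i x hx h => hk i (le_antisymm (hale i x hx) (h _ (haS i)))
  -- Dominance of `S` makes `m` map onto `S`: each point of `T` in `S` is the minimum of `S` for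
  -- some ranking outside `S`. As `ι` has one element more than `S`, exactly two indices `j` can be
  -- spared. Each gives one extension: the top of `Y j` in the ranking `j`, or the index `j` itself
  -- if `Y j` is empty.
  let m : ι → T ⊕ ι := fun i => if Sum.inr i ∈ S then Sum.inr i else Sum.inl (a i)
  have hm_mem : ∀ i, m i ∈ S := by
    intro i
    by_cases h : (Sum.inr i : T ⊕ ι) ∈ S
    · simp [m, h]
    · simp [m, h, haS]
  have hm_inr : ∀ i, Sum.inr i ∈ S → m i = Sum.inr i := fun i h => by simp [m, h]
  have hm_inl : ∀ i x, Sum.inr i ∉ S → Sum.inl x ∈ S →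
      (∀ x', Sum.inl x' ∈ S → k i x ≤ k i x') → m i = Sum.inl x := fun i x hi hx h => by
    simp [m, hi, ha_eq i x hx h]
  have himg_of : ∀ A : Finset ι, (∀ i, Sum.inr i ∈ S → i ∈ A) →
      (∀ x, Sum.inl x ∈ S → ∃ i ∈ A, Sum.inr i ∉ S ∧ ∀ x', Sum.inl x' ∈ S → k i x ≤ k i x') →
      A.image m = S := by
    intro A h1 h2
    apply Finset.Subset.antisymm
    · intro z hz
      obtain ⟨i, -, rfl⟩ := Finset.mem_image.1 hz
      exact hm_mem i
    · rintro (x | i) hz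
      · obtain ⟨i, hiA, hi, hx⟩ := h2 x hz
        exact Finset.mem_image.2 ⟨i, hiA, hm_inl i x hi hz hx⟩
      · exact Finset.mem_image.2 ⟨i, h1 i hz, hm_inr i hz⟩
  have hJ := Finset.card_filter_image_erase_eq_two (s := Finset.univ) (f := m) (t := S)
    (himg_of _ (fun _ _ => Finset.mem_univ _) fun x hx => by
      obtain ⟨i, hi, h⟩ := hS x
      exact ⟨i, Finset.mem_univ _, hi, h⟩) (by rw [Finset.card_univ, hcard])
  -- `Y j` is the set of points that only the ranking `j` can dominate
  let Y : ι → T → Prop := fun j y =>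
    ∀ i, i ≠ j → Sum.inr i ∉ S → ¬ ∀ x, Sum.inl x ∈ S → k i y ≤ k i x
  have hY : ∀ j y, Y j y → Sum.inr j ∉ S ∧ ∀ x, Sum.inl x ∈ S → k j y ≤ k j x := by
    intro j y hy
    obtain ⟨i, hi, h⟩ := hS y
    by_cases hij : i = j
    · subst hij; exact ⟨hi, h⟩
    · exact absurd h (hy i hij hi)
  let Q : ι → T ⊕ ι → Prop := fun j z => z ∉ S ∧ Dominant k (insert z S) ∧
    (z = Sum.inr j ∨ ∃ x, z = Sum.inl x ∧ Y j x)
  have hmax : ∀ j x, Y j x → Dominant k (insert (Sum.inl x) S) → ∀ y, Y j y → k j y ≤ k j x := by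
    intro j x hx hd y hy
    obtain ⟨i, hi, h⟩ := hd y
    by_cases hij : i = j
    · subst hij; exact h x (by simp)
    · exact absurd (fun x' hx' => h x' (by simp [hx'])) (hy i hij (by simpa using hi))
  have hQuniq : ∀ j z z', Q j z → Q j z' → z = z' := by
    have hmixed : ∀ j x, Y j x → ¬ Dominant k (insert (Sum.inr j) S) := by
      intro j x hx hd
      obtain ⟨i, hi, h⟩ := hd x
      simp only [Finset.mem_insert, Sum.inr.injEq, not_or] at hi
      exact hx i hi.1 hi.2 fun x' hx' => h x' (by simp [hx'])
    rintro j z z' ⟨-, hd, rfl | ⟨x, rfl, hx⟩⟩ ⟨-, hd', rfl | ⟨x', rfl, hx'⟩⟩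
    · rfl
    · exact absurd hd (hmixed j x' hx')
    · exact absurd hd' (hmixed j x hx)
    · rw [hk j (le_antisymm (hmax j x' hx' hd' x hx) (hmax j x hx hd x' hx'))]
  have hQinj : ∀ j j' z, Q j z → Q j' z → j = j' := by
    rintro j j' z ⟨-, -, rfl | ⟨x, rfl, hx⟩⟩ ⟨-, -, h | ⟨x', h, hx'⟩⟩
    · simpa using h
    · simp at h
    · simp at h
    · obtain rfl : x = x' := by simpa using h
      by_contra hne
      exact hx' j hne (hY j x hx).1 (hY j x hx).2
  have hQex : ∀ j, (Finset.univ.erase j).image m = S → ∃ z, Q j z := by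
    intro j hj
    have hjS : Sum.inr j ∉ S := by
      intro h
      rw [← hj] at h
      obtain ⟨i, hi, hm⟩ := Finset.mem_image.1 h
      by_cases his : (Sum.inr i : T ⊕ ι) ∈ S
      · rw [hm_inr i his] at hm
        exact (Finset.ne_of_mem_erase hi) (by simpa using hm)
      · simp [m, his] at hm
    by_cases hne : ∃ y, Y j y
    · obtain ⟨y, hy⟩ := hne
      obtain ⟨x, hx, hxmax⟩ := Finset.exists_max_image (Finset.univ.filter (Y j)) (k j)
        ⟨y, by simpa using hy⟩
      replace hx : Y j x := by simpa using hx
      refine ⟨Sum.inl x, ?_, ?_, Or.inr ⟨x, rfl, hx⟩⟩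
      · intro hxS
        rw [← hj] at hxS
        obtain ⟨i, hi, hm⟩ := Finset.mem_image.1 hxS
        by_cases his : (Sum.inr i : T ⊕ ι) ∈ S
        · simp [m, his] at hm
        · simp only [m, his, if_false, Sum.inl.injEq] at hm
          subst hm
          exact hx i (Finset.ne_of_mem_erase hi) his (hale i)
      · intro y
        by_cases hyY : Y j y
        · refine ⟨j, by simpa using hjS, fun x' hx' => ?_⟩
          rcases Finset.mem_insert.1 hx' with h | h
          · obtain rfl : x' = x := by simpa using h
            exact hxmax y (by simpa using hyY)
          · exact (hY j y hyY).2 x' h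
        · simp only [Y] at hyY
          push Not at hyY
          obtain ⟨i, hij, hi, h⟩ := hyY
          refine ⟨i, by simpa using hi, fun x' hx' => ?_⟩
          rcases Finset.mem_insert.1 hx' with h' | h'
          · obtain rfl : x' = x := by simpa using h'
            -- As `x` is in `Y j`, it is no lower bound of `S` in the ranking `i`; it lies above
            -- some point of `S`, hence above `y`.
            have := hx i hij hi
            push Not at this
            obtain ⟨x'', hx'', hlt⟩ := this
            exact (h x'' hx'').trans hlt.le
          · exact h x' h'
    · refine ⟨Sum.inr j, hjS, fun y => ?_, Or.inl rfl⟩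
      have hyY : ¬ Y j y := fun h => hne ⟨y, h⟩
      simp only [Y] at hyY
      push Not at hyY
      obtain ⟨i, hij, hi, h⟩ := hyY
      exact ⟨i, by simp [hij, hi], fun x' hx' => h x' (by simpa using hx')⟩
  have hQsurj : ∀ z, z ∉ S → Dominant k (insert z S) →
      ∃ j, (Finset.univ.erase j).image m = S ∧ Q j z := by
    rintro (x | j) hz hd
    · obtain ⟨j, hj, hxj⟩ := hd x
      have hjS : Sum.inr j ∉ S := by simpa using hj
      -- the indices that give the points of `S` do not have `x` as a lower bound
      have hne : ∀ x', Sum.inl x' ∈ S → ∃ i, Sum.inr i ∉ S ∧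
          (∀ x'', Sum.inl x'' ∈ S → k i x' ≤ k i x'') ∧
          ¬ ∀ x'', Sum.inl x'' ∈ S → k i x ≤ k i x'' := by
        intro x' hx'
        obtain ⟨i, hi, h⟩ := hd x'
        refine ⟨i, by simpa using hi, fun x'' hx'' => h x'' (by simp [hx'']), fun hcon => hz ?_⟩
        rwa [hk i (le_antisymm (hcon x' hx') (h x (by simp)))]
      have hxj' : ∀ x', Sum.inl x' ∈ S → k j x ≤ k j x' := fun x' hx' => hxj x' (by simp [hx'])
      refine ⟨j, himg_of _ ?_ ?_, hz, hd, Or.inr ⟨x, rfl, ?_⟩⟩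
      · intro i hi
        simp only [Finset.mem_erase, Finset.mem_univ, and_true]
        rintro rfl
        exact hjS hi
      · intro x' hx'
        obtain ⟨i, hi, h, hn⟩ := hne x' hx'
        refine ⟨i, ?_, hi, h⟩
        simp only [Finset.mem_erase, Finset.mem_univ, and_true]
        rintro rfl
        exact hn hxj'
      · intro i hij hiS hcon
        -- If `x` were a lower bound for `i` as well as for `j`, both indices could be spared at
        -- once, leaving too few to cover `S`.
        have himg : ((Finset.univ.erase j).erase i).image m = S := by
          refine himg_of _ ?_ ?_
          · intro i' hi'
            simp only [Finset.mem_erase, Finset.mem_univ, and_true]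
            exact ⟨by rintro rfl; exact hiS hi', by rintro rfl; exact hjS hi'⟩
          · intro x' hx'
            obtain ⟨i', hi', h, hn⟩ := hne x' hx'
            refine ⟨i', ?_, hi', h⟩
            simp only [Finset.mem_erase, Finset.mem_univ, and_true]
            exact ⟨by rintro rfl; exact hn hcon, by rintro rfl; exact hn hxj'⟩
        have h1 := Finset.card_image_le (s := (Finset.univ.erase j).erase i) (f := m)
        rw [himg, Finset.card_erase_of_mem (by simp [hij]),
          Finset.card_erase_of_mem (by simp), Finset.card_univ] at h1
        have h2 : 0 < S.card := Finset.card_pos.2 ⟨_, hx₀⟩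
        omega
    · refine ⟨j, himg_of _ ?_ ?_, hz, hd, Or.inl rfl⟩
      · intro i hi
        simp only [Finset.mem_erase, Finset.mem_univ, and_true]
        rintro rfl
        exact hz hi
      · intro x hx
        obtain ⟨i, hi, h⟩ := hd x
        simp only [Finset.mem_insert, Sum.inr.injEq, not_or] at hi
        exact ⟨i, by simp [hi.1], hi.2, fun x' hx' => h x' (by simp [hx'])⟩
  rw [← hJ]
  symm
  have : Nonempty (T ⊕ ι) := ⟨Sum.inl x₀⟩
  choose! g hg using hQex
  refine Finset.card_bij (fun j _ => g j) ?_ ?_ ?_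
  · intro j hj
    have := hg j (by simpa using hj)
    simpa using ⟨this.1, this.2.1⟩
  · intro j hj j' hj' h
    refine hQinj j j' (g j) (hg j (by simpa using hj)) ?_
    rw [h]
    exact hg j' (by simpa using hj')
  · intro z hz
    have hz' : z ∉ S ∧ Dominant k (insert z S) := by simpa using hz
    obtain ⟨j, hj, hQ⟩ := hQsurj z hz'.1 hz'.2
    exact ⟨j, by simpa using hj, hQuniq j _ _ (hg j hj) hQ⟩

/-- The set of all indices but one has exactly one dominant extension by one element. -/
theorem Dominant.card_extensions_eq_one [Nonempty T] {k : ι → T → ℕ}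
    (hk : ∀ i, Function.Injective (k i)) (i₀ : ι) {S : Finset (T ⊕ ι)}
    (hS : ∀ z, z ∈ S ↔ ∃ i, i ≠ i₀ ∧ z = Sum.inr i)
    [DecidablePred fun z => z ∉ S ∧ Dominant k (insert z S)] :
    (Finset.univ.filter fun z => z ∉ S ∧ Dominant k (insert z S)).card = 1 := by
  -- Only `i₀` is left to dominate, so the added element has to be the top of its ranking.
  obtain ⟨x, -, hx⟩ := Finset.exists_max_image (Finset.univ : Finset T) (k i₀)
    Finset.univ_nonempty
  rw [Finset.card_eq_one]
  refine ⟨Sum.inl x, ?_⟩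
  ext z
  simp only [Finset.mem_filter, Finset.mem_univ, true_and, Finset.mem_singleton]
  constructor
  · rintro ⟨hz, hd⟩
    have hi₀ : ∀ i, Sum.inr i ∉ insert z S → i = i₀ := by
      intro i hi
      by_contra hne
      exact hi (Finset.mem_insert_of_mem ((hS _).2 ⟨i, hne, rfl⟩))
    obtain ⟨i, hi, h⟩ := hd x
    obtain rfl := hi₀ i hi
    rcases z with y | i'
    · rw [hk i (le_antisymm (h y (by simp)) (hx y (Finset.mem_univ _)))]
    · exfalso
      by_cases hne : i' = i
      · subst hne; simp at hi
      · exact hz ((hS _).2 ⟨i', hne, rfl⟩)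
  · rintro rfl
    refine ⟨by simp [hS], fun y => ⟨i₀, by simp [hS], fun x' hx' => ?_⟩⟩
    obtain rfl : x' = x := by simpa [hS] using hx'
    exact hx y (Finset.mem_univ _)

/-- For every colouring of `T ⊕ ι` that colours each index by itself there is a dominant set with
all colours. -/
theorem exists_dominant_image_eq_univ [Nonempty T] {k : ι → T → ℕ}
    (hk : ∀ i, Function.Injective (k i)) (i₀ : ι) (c : T ⊕ ι → ι) (hc : ∀ i, c (Sum.inr i) = i) :
    ∃ R, Dominant k R ∧ R.image c = Finset.univ := by
  classical
  by_contra! hno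
  -- Count pairs of a door and a room containing it. If no room has all colours, a room with a door
  -- shows exactly the colours other than `i₀` and so has two doors: the count is even. A door
  -- meeting `T` lies in two rooms, and the only other door, all indices but `i₀`, lies in one: the
  -- count is odd.
  let doors : Finset (Finset (T ⊕ ι)) := Finset.univ.filter fun S =>
    S.card + 1 = Fintype.card ι ∧ Dominant k S ∧ S.image c = Finset.univ.erase i₀
  let rooms : Finset (Finset (T ⊕ ι)) := Finset.univ.filter fun R =>
    R.card = Fintype.card ι ∧ Dominant k R
  have hcount : ∑ S ∈ doors, (Finset.univ.filter fun z => z ∉ S ∧ Dominant k (insert z S)).card =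
      ∑ R ∈ rooms, (R.filter fun z => (R.erase z).image c = Finset.univ.erase i₀).card := by
    rw [← Finset.card_sigma, ← Finset.card_sigma]
    refine Finset.card_bij' (fun a _ => ⟨insert a.2 a.1, a.2⟩) (fun a _ => ⟨a.1.erase a.2, a.2⟩)
      ?_ ?_ ?_ ?_
    · rintro ⟨S, z⟩ h
      simp only [doors, Finset.mem_sigma, Finset.mem_filter, Finset.mem_univ, true_and] at h
      obtain ⟨⟨h1, h2, h3⟩, h4, h5⟩ := h
      simp only [rooms, Finset.mem_sigma, Finset.mem_filter, Finset.mem_univ, true_and]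
      exact ⟨⟨by rw [Finset.card_insert_of_notMem h4, h1], h5⟩, by simp,
        by rw [Finset.erase_insert h4, h3]⟩
    · rintro ⟨R, z⟩ h
      simp only [rooms, Finset.mem_sigma, Finset.mem_filter, Finset.mem_univ, true_and] at h
      obtain ⟨⟨h1, h2⟩, h3, h4⟩ := h
      simp only [doors, Finset.mem_sigma, Finset.mem_filter, Finset.mem_univ, true_and]
      exact ⟨⟨by rw [Finset.card_erase_add_one h3, h1], h2.mono (Finset.erase_subset _ _), h4⟩,
        by simp, by rwa [Finset.insert_erase h3]⟩
    · rintro ⟨S, z⟩ h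
      simp only [doors, Finset.mem_sigma, Finset.mem_filter, Finset.mem_univ, true_and] at h
      simp [Finset.erase_insert h.2.1]
    · rintro ⟨R, z⟩ h
      simp only [rooms, Finset.mem_sigma, Finset.mem_filter, Finset.mem_univ, true_and] at h
      simp [Finset.insert_erase h.2.1]
  have hrooms : Even (∑ R ∈ rooms,
      (R.filter fun z => (R.erase z).image c = Finset.univ.erase i₀).card) := by
    refine Finset.even_sum _ fun R hR => ?_
    obtain ⟨hR1, hR2⟩ : R.card = Fintype.card ι ∧ Dominant k R := by simpa [rooms] using hR
    by_cases himg : R.image c = Finset.univ.erase i₀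
    · rw [Finset.card_filter_image_erase_eq_two himg
        (by rw [Finset.card_erase_add_one (Finset.mem_univ _), hR1, Finset.card_univ])]
      exact even_two
    · rw [Finset.filter_eq_empty_iff.2]
      · simp
      · intro z hz h
        have hsub : Finset.univ.erase i₀ ⊆ R.image c :=
          h ▸ Finset.image_subset_image (Finset.erase_subset _ _)
        by_cases hi : i₀ ∈ R.image c
        · refine hno R hR2 (Finset.eq_univ_iff_forall.2 fun i => ?_)
          by_cases hii : i = i₀
          · rwa [hii]
          · exact hsub (by simp [hii])
        · refine himg (Finset.Subset.antisymm (fun i hi' => ?_) hsub)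
          simp only [Finset.mem_erase, Finset.mem_univ, and_true]
          rintro rfl
          exact hi hi'
  let S₀ : Finset (T ⊕ ι) := (Finset.univ.erase i₀).image Sum.inr
  have hS₀ : ∀ z, z ∈ S₀ ↔ ∃ i, i ≠ i₀ ∧ z = Sum.inr i := by
    intro z
    simp [S₀, eq_comm]
  have hS₀d : S₀ ∈ doors := by
    simp only [doors, Finset.mem_filter, Finset.mem_univ, true_and]
    refine ⟨?_, fun y => ⟨i₀, by simp [hS₀], fun x hx => by simp [hS₀] at hx⟩, ?_⟩
    · rw [Finset.card_image_of_injective _ Sum.inr_injective,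
        Finset.card_erase_add_one (Finset.mem_univ _), Finset.card_univ]
    · rw [Finset.image_image]
      ext i
      simp [hc]
  rw [← hcount, ← Finset.add_sum_erase _ _ hS₀d,
    Dominant.card_extensions_eq_one hk i₀ hS₀] at hrooms
  have heven : Even (∑ S ∈ doors.erase S₀,
      (Finset.univ.filter fun z => z ∉ S ∧ Dominant k (insert z S)).card) := by
    refine Finset.even_sum _ fun S hS => ?_
    obtain ⟨hne, hS⟩ := Finset.mem_erase.1 hS
    obtain ⟨h1, h2, h3⟩ : S.card + 1 = Fintype.card ι ∧ Dominant k S ∧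
      S.image c = Finset.univ.erase i₀ := by simpa [doors] using hS
    by_cases hx : ∃ x, Sum.inl x ∈ S
    · obtain ⟨x, hx⟩ := hx
      rw [h2.card_extensions_eq_two hk h1 hx]
      exact even_two
    · refine absurd (Finset.ext fun z => ?_) hne
      rw [hS₀]
      constructor
      · intro hz
        rcases z with x | i
        · exact absurd ⟨x, hz⟩ hx
        · refine ⟨i, ?_, rfl⟩
          have := Finset.mem_image_of_mem c hz
          rw [h3, hc] at this
          exact Finset.ne_of_mem_erase this
      · rintro ⟨i, hi, rfl⟩
        have : i ∈ S.image c := by rw [h3]; simp [hi]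
        obtain ⟨z, hz, hzi⟩ := Finset.mem_image.1 this
        rcases z with x | i'
        · exact absurd ⟨x, hz⟩ hx
        · rw [hc] at hzi
          rwa [← hzi]
  rw [Nat.even_add] at hrooms
  simp [heven] at hrooms

/-- Scarf's combinatorial lemma. -/
theorem exists_dominating_colorful [Nonempty T] [Nonempty ι] {k : ι → T → ℕ}
    (hk : ∀ i, Function.Injective (k i)) (c : T → ι) :
    ∃ (C : Finset ι) (g : ι → T), (∀ i ∈ C, c (g i) = i) ∧
      ∀ y, ∃ i ∈ C, ∀ l ∈ C, k i y ≤ k i (g l) := by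
  classical
  obtain ⟨R, hR, himg⟩ := exists_dominant_image_eq_univ hk (Classical.arbitrary ι)
    (Sum.elim c id) (fun i => rfl)
  -- An index carries only its own colour, so a colour whose index is missing from `R` is carried by
  -- a point of `T`. For the other colours the value is irrelevant.
  have hg : ∀ i, ∃ x, Sum.inr i ∉ R → Sum.inl x ∈ R ∧ c x = i := by
    intro i
    have : i ∈ R.image (Sum.elim c id) := himg ▸ Finset.mem_univ i
    obtain ⟨z | i', hz, hzi⟩ := Finset.mem_image.1 this
    · exact ⟨z, fun _ => ⟨hz, hzi⟩⟩
    · obtain rfl : i' = i := hzi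
      exact ⟨Classical.arbitrary T, fun h => absurd hz h⟩
  choose g hg using hg
  refine ⟨Finset.univ.filter fun i => Sum.inr i ∉ R, g, fun i hi => (hg i (by simpa using hi)).2,
    fun y => ?_⟩
  obtain ⟨i, hi, h⟩ := hR y
  exact ⟨i, by simpa using hi, fun l hl => h _ (hg l (by simpa using hl)).1⟩

end Scarf

/-! ### Covers of the simplex -/

section Simplex

variable {ι : Type*} [Fintype ι]

open Filter Topology

/-- In every colouring of the integer points of a dilated simplex there are points of all colours
in some set `C`, close to each other and to the face spanned by `C`. -/
theorem exists_near_colorful_grid [Nonempty ι] (N : ℕ) (c : (ι → ℕ) → ι) :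
    ∃ (C : Finset ι) (g : ι → ι → ℕ), C.Nonempty ∧ (∀ i ∈ C, ∑ j, g i j = N ∧ c (g i) = i) ∧
      (∀ l ∈ C, ∀ l' ∈ C, ∀ i, g l i ≤ g l' i + Fintype.card ι) ∧
      ∀ l ∈ C, ∀ i ∉ C, g l i ≤ Fintype.card ι := by
  classical
  let T := {a : ι → ℕ // a ∈ Finset.piAntidiag (Finset.univ : Finset ι) N}
  have hmem : ∀ a : ι → ℕ, a ∈ Finset.piAntidiag (Finset.univ : Finset ι) N ↔ ∑ j, a j = N := by
    simp [Finset.mem_piAntidiag]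
  have : Nonempty T := ⟨⟨Pi.single (Classical.arbitrary ι) N, by rw [hmem]; simp⟩⟩
  let e := Fintype.equivFin T
  -- Compare `i`-th coordinates; the enumeration `e` breaks ties, since rankings must be injective.
  let k : ι → T → ℕ := fun i a => a.1 i * Fintype.card T + e a
  have hle : ∀ i a b, k i a ≤ k i b → a.1 i ≤ b.1 i := by
    intro i a b h
    by_contra! hlt
    have h1 : (b.1 i + 1) * Fintype.card T ≤ a.1 i * Fintype.card T := Nat.mul_le_mul_right _ hlt
    have h2 := (e b).2
    simp only [k] at h
    rw [add_one_mul] at h1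
    omega
  have hk : ∀ i, Function.Injective (k i) := by
    intro i a b h
    have h1 := le_antisymm (hle i a b h.le) (hle i b a h.ge)
    simp only [k, h1] at h
    exact e.injective (Fin.ext (by omega))
  obtain ⟨C, g, hc, hdom⟩ := exists_dominating_colorful hk fun a => c a.1
  have hCne : C.Nonempty := by
    obtain ⟨i, hi, -⟩ := hdom (Classical.arbitrary T)
    exact ⟨i, hi⟩
  have hmin : ∀ i, ∃ l ∈ C, ∀ l' ∈ C, (g l).1 i ≤ (g l').1 i := fun i =>
    Finset.exists_min_image C (fun l => (g l).1 i) hCne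
  choose b hbC hb using hmin
  let m : ι → ℕ := fun i => (g (b i)).1 i
  have hsum : ∀ l, ∑ j, (g l).1 j = N := fun l => (hmem _).1 (g l).2
  have hm : N < ∑ i ∈ C, (m i + 1) := by
    -- Otherwise some grid point exceeds every minimum `m i` with `i ∈ C`, the surplus being put on
    -- `i₀`, and no index of `C` dominates it.
    by_contra! hle'
    obtain ⟨i₀, hi₀⟩ := hCne
    let y : ι → ℕ := (fun i => if i ∈ C then m i + 1 else 0) +
      Pi.single i₀ (N - ∑ i ∈ C, (m i + 1))
    have hy : ∑ j, y j = N := by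
      simp only [y, Pi.add_apply, Finset.sum_add_distrib, Finset.sum_ite_mem, Finset.univ_inter,
        Finset.sum_pi_single', Finset.mem_univ, if_true]
      simp only [Finset.sum_add_distrib] at hle' ⊢
      omega
    obtain ⟨i, hi, h⟩ := hdom ⟨y, (hmem y).2 hy⟩
    have h1 := hle _ _ _ (h (b i) (hbC i))
    have h2 : m i + 1 ≤ y i := by simp [y, hi]
    exact absurd (h2.trans h1) (by simp [m])
  -- The minima over `C` thus leave less than `C.card` of the total `N`, which bounds both the
  -- coordinates outside `C` and the excess of any coordinate over its minimum.
  rw [Finset.sum_add_distrib, Finset.sum_const, smul_eq_mul, mul_one] at hm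
  have hCn : C.card ≤ Fintype.card ι := Finset.card_le_univ C
  have hsplit : ∀ l, ∑ i ∈ C, (g l).1 i + ∑ i ∈ Cᶜ, (g l).1 i = N := fun l => by
    rw [Finset.sum_add_sum_compl, hsum]
  have hmg : ∀ l ∈ C, ∑ i ∈ C, m i ≤ ∑ i ∈ C, (g l).1 i := fun l hl =>
    Finset.sum_le_sum fun i _ => hb i l hl
  have hout : ∀ l ∈ C, ∀ i ∉ C, (g l).1 i ≤ Fintype.card ι := by
    intro l hl i hi
    have h1 := Finset.single_le_sum (f := (g l).1) (fun _ _ => Nat.zero_le _)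
      (Finset.mem_compl.2 hi)
    have h2 := hsplit l
    have h3 := hmg l hl
    omega
  refine ⟨C, fun i => (g i).1, hCne, fun i hi => ⟨hsum i, hc i hi⟩, fun l hl l' hl' i => ?_, hout⟩
  by_cases hi : i ∈ C
  · have h1 : (g l).1 i + ∑ j ∈ C.erase i, m j ≤ ∑ j ∈ C, (g l).1 j := by
      rw [← Finset.add_sum_erase C _ hi]
      exact Nat.add_le_add_left (Finset.sum_le_sum fun j _ => hb j l hl) _
    have h2 := Finset.add_sum_erase C m hi
    have h3 := hsplit l
    have h4 : m i ≤ (g l').1 i := hb i l' hl'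
    show (g l).1 i ≤ (g l').1 i + Fintype.card ι
    omega
  · exact (hout l hl i hi).trans (Nat.le_add_left _ _)

/-- A cover of the simplex by sets `F i` has, up to `ε`, a point that lies in all the `F i` with
`i` in its support. -/
theorem exists_approx_mem_of_cover_stdSimplex [Nonempty ι] (F : ι → Set (ι → ℝ))
    (hF : ∀ x ∈ stdSimplex ℝ ι, ∃ i, x ∈ F i) {ε : ℝ} (hε : 0 < ε) :
    ∃ x ∈ stdSimplex ℝ ι, ∀ i, ε < x i → ∃ y ∈ F i, dist y x ≤ ε := by
  classical
  obtain ⟨N, hN⟩ := exists_nat_gt ((Fintype.card ι : ℝ) / ε)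
  have hN0 : (0 : ℝ) < N := lt_of_le_of_lt (by positivity) hN
  have hnε : (Fintype.card ι : ℝ) / N ≤ ε := by
    rw [div_lt_iff₀ hε] at hN
    rw [div_le_iff₀ hN0]
    linarith
  let s : (ι → ℕ) → ι → ℝ := fun a j => a j / N
  have hs : ∀ a, ∑ j, a j = N → s a ∈ stdSimplex ℝ ι := by
    intro a ha
    refine ⟨fun j => by positivity, ?_⟩
    simp only [s, ← Finset.sum_div]
    rw [← Nat.cast_sum, ha, div_self hN0.ne']
  have hcol : ∀ a : ι → ℕ, ∃ i, ∑ j, a j = N → s a ∈ F i := by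
    intro a
    by_cases ha : ∑ j, a j = N
    · obtain ⟨i, hi⟩ := hF _ (hs a ha)
      exact ⟨i, fun _ => hi⟩
    · exact ⟨Classical.arbitrary ι, fun h => absurd h ha⟩
  choose c hc using hcol
  obtain ⟨C, g, ⟨l, hl⟩, hg, hnear, hout⟩ := exists_near_colorful_grid N c
  -- Any colourful point serves as `x`: a coordinate above `ε` forces `i ∈ C`, and then `s (g i)` is
  -- the required nearby point of `F i`.
  refine ⟨s (g l), hs _ (hg l hl).1, fun i hi => ?_⟩
  have hiC : i ∈ C := by
    by_contra hiC
    have h1 : (g l i : ℝ) ≤ Fintype.card ι := by exact_mod_cast hout l hl i hiC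
    have h2 : (g l i : ℝ) / N ≤ Fintype.card ι / N := by gcongr
    exact absurd hi (not_lt.2 (h2.trans hnε))
  refine ⟨s (g i), ?_, (dist_pi_le_iff hε.le).2 fun j => ?_⟩
  · have := hc _ (hg i hiC).1
    rwa [(hg i hiC).2] at this
  · have h1 : (g i j : ℝ) ≤ g l j + Fintype.card ι := by exact_mod_cast hnear i hiC l hl j
    have h2 : (g l j : ℝ) ≤ g i j + Fintype.card ι := by exact_mod_cast hnear l hl i hiC j
    refine le_trans ?_ hnε
    rw [Real.dist_eq, ← sub_div, abs_div, abs_of_pos hN0]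
    gcongr
    rw [abs_le]
    constructor <;> linarith

/-- A closed cover of the simplex has a point that lies in all members indexed by its support. -/
theorem exists_mem_of_closed_cover_stdSimplex [Nonempty ι] (F : ι → Set (ι → ℝ))
    (hcl : ∀ i, IsClosed (F i)) (hF : ∀ x ∈ stdSimplex ℝ ι, ∃ i, x ∈ F i) :
    ∃ x ∈ stdSimplex ℝ ι, ∀ i, 0 < x i → x ∈ F i := by
  have happrox := fun n : ℕ => exists_approx_mem_of_cover_stdSimplex F hF
    (Nat.one_div_pos_of_nat (α := ℝ) (n := n))
  choose x hx hxF using happrox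
  obtain ⟨x₀, hx₀, φ, hφ, hlim⟩ := (isCompact_stdSimplex (𝕜 := ℝ) ι).tendsto_subseq hx
  refine ⟨x₀, hx₀, fun i hi => ?_⟩
  have hε : Tendsto (fun n => 1 / ((φ n : ℝ) + 1)) atTop (𝓝 0) :=
    tendsto_one_div_add_atTop_nhds_zero_nat.comp hφ.tendsto_atTop
  -- A positive coordinate of the limit eventually exceeds the tolerance, so approximate membership
  -- applies.
  have hlt : ∀ᶠ n in atTop, 1 / ((φ n : ℝ) + 1) < x (φ n) i :=
    hε.eventually_lt (((continuous_apply i).tendsto x₀).comp hlim) hi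
  rw [← (hcl i).closure_eq, Metric.mem_closure_iff]
  intro δ hδ
  obtain ⟨n, h1, h2, h3⟩ := (hlt.and ((hε.eventually_lt_const (half_pos hδ)).and
    (Metric.tendsto_nhds.1 hlim (δ / 2) (half_pos hδ)))).exists
  obtain ⟨y, hy, hd⟩ := hxF (φ n) i h1
  refine ⟨y, hy, ?_⟩
  have := dist_triangle y (x (φ n)) x₀
  rw [dist_comm]
  simp only [Function.comp_apply] at h3
  linarith

end Simplex

/-! ### Ky Fan's inequality -/

section KyFan

variable {E : Type*} [AddCommGroup E] [Module ℝ E] [TopologicalSpace E] [ContinuousAdd E]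
  [ContinuousSMul ℝ E]

/-- Ky Fan's inequality for finitely many test points. -/
theorem exists_forall_le_diag_of_finite {ι : Type*} [Finite ι] [Nonempty ι] {K : Set E}
    (hconv : Convex ℝ K) {φ : E → E → ℝ} (hcont : ∀ y ∈ K, ContinuousOn (fun x => φ x y) K)
    (hconc : ∀ x ∈ K, QuasiconcaveOn ℝ K (φ x)) (τ : ι → E) (hτ : ∀ i, τ i ∈ K) :
    ∃ x ∈ K, ∀ i, φ x (τ i) ≤ φ x x := by
  have := Fintype.ofFinite ι
  let mix : (ι → ℝ) → E := fun a => ∑ i, a i • τ i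
  have hmix : Continuous mix := by fun_prop
  have hmixK : ∀ a ∈ stdSimplex ℝ ι, mix a ∈ K := fun a ha =>
    hconv.sum_mem (fun i _ => ha.1 i) ha.2 fun i _ => hτ i
  -- `F i` collects the weights against whose mixture `τ i` is a best test point. Where every `τ i`
  -- of positive weight is best, quasiconcavity makes the mixture at least as good.
  let F : ι → Set (ι → ℝ) := fun i =>
    {a | a ∈ stdSimplex ℝ ι ∧ ∀ j, φ (mix a) (τ j) ≤ φ (mix a) (τ i)}
  have hc : ∀ j, ContinuousOn (fun a => φ (mix a) (τ j)) (stdSimplex ℝ ι) := fun j =>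
    (hcont (τ j) (hτ j)).comp hmix.continuousOn hmixK
  have hcl : ∀ i, IsClosed (F i) := by
    intro i
    have : F i = stdSimplex ℝ ι ∩
        ⋂ j, {a | a ∈ stdSimplex ℝ ι ∧ φ (mix a) (τ j) ≤ φ (mix a) (τ i)} := by
      ext a
      simp only [F, Set.mem_ofPred_eq, Set.mem_inter_iff, Set.mem_iInter]
      exact ⟨fun h => ⟨h.1, fun j => ⟨h.1, h.2 j⟩⟩, fun h => ⟨h.1, fun j => (h.2 j).2⟩⟩
    rw [this]
    exact (isClosed_stdSimplex ℝ ι).inter (isClosed_iInter fun j =>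
      (isClosed_stdSimplex ℝ ι).isClosed_le (hc j) (hc i))
  obtain ⟨a, ha, haF⟩ := exists_mem_of_closed_cover_stdSimplex F hcl fun a ha => by
    obtain ⟨i, hi⟩ := Finite.exists_max fun i => φ (mix a) (τ i)
    exact ⟨i, ha, hi⟩
  refine ⟨mix a, hmixK a ha, fun j => ?_⟩
  have hmem : ∑ i with a i ≠ 0, a i • τ i ∈ {y ∈ K | φ (mix a) (τ j) ≤ φ (mix a) y} := by
    refine (hconc _ (hmixK a ha) _).sum_mem (fun i _ => ha.1 i) ?_ fun i hi => ⟨hτ i, ?_⟩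
    · rw [Finset.sum_filter_ne_zero]
      exact ha.2
    · exact (haF i (lt_of_le_of_ne (ha.1 i) (Ne.symm (by simpa using hi)))).2 j
  have heq : ∑ i with a i ≠ 0, a i • τ i = mix a := by
    refine Finset.sum_subset (Finset.filter_subset _ _) fun i _ hi => ?_
    have : a i = 0 := by simpa using hi
    rw [this, zero_smul]
  rw [heq] at hmem
  exact hmem.2

/-- Ky Fan's inequality. -/
theorem exists_forall_le_diag {K : Set E} (hne : K.Nonempty) (hcomp : IsCompact K)
    (hconv : Convex ℝ K) {φ : E → E → ℝ} (hcont : ∀ y ∈ K, ContinuousOn (fun x => φ x y) K)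
    (hdiag : ContinuousOn (fun x => φ x x) K) (hconc : ∀ x ∈ K, QuasiconcaveOn ℝ K (φ x)) :
    ∃ x ∈ K, ∀ y ∈ K, φ x y ≤ φ x x := by
  have := isCompact_iff_compactSpace.1 hcomp
  let A : K → Set K := fun y => {x | φ x y ≤ φ x x}
  have hA : (⋂ y, A y).Nonempty := by
    refine CompactSpace.iInter_nonempty (fun y => ?_) fun s => ?_
    · exact isClosed_le (hcont y y.2).domRestrict hdiag.domRestrict
    · rcases s.eq_empty_or_nonempty with rfl | hs
      · have := hne.to_subtype
        simp
      · have := hs.to_subtype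
        obtain ⟨x, hx, h⟩ := exists_forall_le_diag_of_finite hconv hcont hconc
          (fun y : s => (y : K).1) fun y => y.1.2
        exact ⟨⟨x, hx⟩, by simpa [A] using fun y hy hys => h ⟨⟨y, hy⟩, hys⟩⟩
  obtain ⟨x, hx⟩ := hA
  exact ⟨x, x.2, fun y hy => Set.mem_iInter.1 hx ⟨y, hy⟩⟩

end KyFan

/-! ### Payoffs, gluing and deviations -/

namespace KripkeGame

theorem classOf_eq_of_mem_classFinset {P : Type u} {W : Type v} [Fintype W]
    (G : KripkeGame.{u, v, w} P W) {p : P} {x y : W} (h : y ∈ G.classFinset p x) :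
    G.classOf p y = G.classOf p x :=
  Quotient.sound (by simpa [classFinset] using h)

variable {P : Type u} {W : Type v} [Fintype P] [DecidableEq P] [Fintype W]
  (G : KripkeGame.{u, v, w} P W)

/-- The multilinear extension of `KripkeGame.expectedPayoff` to arbitrary weights on the pure
strategies. -/
noncomputable def weightedPayoff (σ : ∀ p, G.PureStrategy p → ℝ) (p : P) (x : W) : ℝ :=
  ∑ s : G.PureProfile, (∏ q, σ q (s q)) * G.utility p x (G.specialize s x)

theorem continuous_weightedPayoff (p : P) (x : W) :
    Continuous fun σ => G.weightedPayoff σ p x := by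
  unfold weightedPayoff
  fun_prop

theorem weightedPayoff_update (σ : ∀ p, G.PureStrategy p → ℝ) (p : P)
    (t : G.PureStrategy p → ℝ) (x : W) :
    G.weightedPayoff (Function.update σ p t) p x = ∑ s : G.PureProfile,
      t (s p) * ((∏ q ∈ Finset.univ.erase p, σ q (s q)) * G.utility p x (G.specialize s x)) := by
  refine Finset.sum_congr rfl fun s _ => ?_
  rw [← Finset.mul_prod_erase _ _ (Finset.mem_univ p), Function.update_self, mul_assoc]
  congr 2
  refine Finset.prod_congr rfl fun q hq => ?_
  rw [Function.update_of_ne (Finset.ne_of_mem_erase hq)]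

theorem weightedPayoff_update_add_smul (σ : ∀ p, G.PureStrategy p → ℝ) (p : P)
    (t t' : G.PureStrategy p → ℝ) (a b : ℝ) (x : W) :
    G.weightedPayoff (Function.update σ p (a • t + b • t')) p x =
      a * G.weightedPayoff (Function.update σ p t) p x +
        b * G.weightedPayoff (Function.update σ p t') p x := by
  simp only [weightedPayoff_update, Finset.mul_sum, ← Finset.sum_add_distrib]
  refine Finset.sum_congr rfl fun s _ => ?_
  simp only [Pi.add_apply, Pi.smul_apply, smul_eq_mul]
  ring

/-- The payoff of player `p` computed in the world `x` if she plays the pure strategy `f` and the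
other players follow `σ`. -/
noncomputable def purePayoff (σ : G.Play) (p : P) (x : W) (f : G.PureStrategy p) : ℝ :=
  ∑ s : G.PureProfile,
    (∏ q, (σ q : G.PureStrategy q → ℝ) (s q)) * G.utility p x
      (G.specialize (Function.update s p f) x)

/-- This decouples the classes: the strategy `f` enters the payoff in `x` only at the class of `x`.
-/
theorem purePayoff_congr (σ : G.Play) (p : P) (x : W) {f f' : G.PureStrategy p}
    (h : f (G.classOf p x) = f' (G.classOf p x)) : G.purePayoff σ p x f = G.purePayoff σ p x f' := by
  have : ∀ s : G.PureProfile, G.specialize (Function.update s p f) x =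
      G.specialize (Function.update s p f') x := by
    intro s
    funext q
    by_cases hq : q = p
    · subst hq
      simpa [specialize] using h
    · simp [specialize, Function.update_of_ne hq]
  simp only [purePayoff, this]

theorem expectedPayoff_update (σ : G.Play) (p : P) (t : G.MixedStrategy p) (x : W) :
    G.expectedPayoff (Function.update σ p t) p x =
      ∑ f, (t : G.PureStrategy p → ℝ) f * G.purePayoff σ p x f := by
  have hcoe : G.expectedPayoff (Function.update σ p t) p x =
      G.weightedPayoff (Function.update (fun q => (σ q : G.PureStrategy q → ℝ)) p t) p x := by
    refine Finset.sum_congr rfl fun s _ => ?_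
    congr 1
    refine Finset.prod_congr rfl fun q _ => ?_
    by_cases hq : q = p
    · subst hq; simp
    · simp [Function.update_of_ne hq]
  rw [hcoe, weightedPayoff_update]
  -- `purePayoff` still draws a strategy of `p` from `σ p` and then overwrites it. To match this, a
  -- redundant draw from `σ p` is added, at total weight one, and exchanged with the draw from `t`.
  let swap : G.PureStrategy p × G.PureProfile → G.PureStrategy p × G.PureProfile :=
    fun a => (a.2 p, Function.update a.2 p a.1)
  have hswap : Function.Involutive swap := by
    rintro ⟨f, s⟩
    simp [swap]
  let A : G.PureProfile → ℝ := fun s => ∏ q ∈ Finset.univ.erase p, (σ q : G.PureStrategy q → ℝ) (s q)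
  have hA : ∀ s f, A (Function.update s p f) = A s := by
    intro s f
    refine Finset.prod_congr rfl fun q hq => ?_
    rw [Function.update_of_ne (Finset.ne_of_mem_erase hq)]
  calc ∑ s : G.PureProfile, (t : G.PureStrategy p → ℝ) (s p) *
        (A s * G.utility p x (G.specialize s x))
      = ∑ f, ∑ s : G.PureProfile, (σ p : G.PureStrategy p → ℝ) f *
          ((t : G.PureStrategy p → ℝ) (s p) * (A s * G.utility p x (G.specialize s x))) := by
        simp only [← Finset.mul_sum, ← Finset.sum_mul]
        rw [stdSimplex.sum_eq_one, one_mul]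
    _ = ∑ f, ∑ s : G.PureProfile, (σ p : G.PureStrategy p → ℝ) (s p) *
          ((t : G.PureStrategy p → ℝ) f *
            (A s * G.utility p x (G.specialize (Function.update s p f) x))) := by
        rw [← Fintype.sum_prod_type', ← Fintype.sum_prod_type']
        refine Fintype.sum_equiv hswap.toPerm _ _ ?_
        rintro ⟨f, s⟩
        simp [swap, hA]
    _ = ∑ f, (t : G.PureStrategy p → ℝ) f * G.purePayoff σ p x f := by
        refine Finset.sum_congr rfl fun f _ => ?_
        rw [purePayoff, Finset.mul_sum]
        refine Finset.sum_congr rfl fun s _ => ?_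
        rw [← Finset.mul_prod_erase _ _ (Finset.mem_univ p)]
        ring

open Classical in
/-- Two mixed strategies of a player can be glued: one is followed in the class `c`, the other one
in all other classes. -/
theorem exists_glued_strategy (p : P) (c : G.WorldClass p) (t t' : G.MixedStrategy p) :
    ∃ r : G.MixedStrategy p, ∀ (σ : G.Play) (x : W),
      G.expectedPayoff (Function.update σ p r) p x =
        if G.classOf p x = c then G.expectedPayoff (Function.update σ p t) p x
        else G.expectedPayoff (Function.update σ p t') p x := by
  -- Draw `g` from `t` and `h` from `t'` independently and overwrite `h` at `c`; `w` is the law of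
  -- the result. Correlations between `c` and the other classes are lost, but no payoff depends on
  -- them.
  let glue : G.PureStrategy p → G.PureStrategy p → G.PureStrategy p := fun g h =>
    Function.update h c (g c)
  let w : G.PureStrategy p → ℝ := fun f => ∑ g, ∑ h,
    (t : G.PureStrategy p → ℝ) g * (t' : G.PureStrategy p → ℝ) h * if f = glue g h then 1 else 0
  have hw : ∀ B : G.PureStrategy p → ℝ, ∑ f, w f * B f =
      ∑ g, ∑ h, (t : G.PureStrategy p → ℝ) g * (t' : G.PureStrategy p → ℝ) h * B (glue g h) := by
    intro B
    simp only [w, Finset.sum_mul]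
    rw [Finset.sum_comm]
    refine Finset.sum_congr rfl fun g _ => ?_
    rw [Finset.sum_comm]
    refine Finset.sum_congr rfl fun h _ => ?_
    simp
  have hw1 : ∑ f, w f = 1 := by
    have := hw fun _ => 1
    simp only [mul_one, ← Finset.mul_sum] at this
    simp only [this, stdSimplex.sum_eq_one, mul_one]
  refine ⟨⟨w, fun f => Finset.sum_nonneg fun g _ => Finset.sum_nonneg fun h _ =>
    mul_nonneg (mul_nonneg (t.2.1 g) (t'.2.1 h)) (by split_ifs <;> norm_num), hw1⟩, ?_⟩
  intro σ x
  simp only [expectedPayoff_update]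
  refine (hw (G.purePayoff σ p x)).trans ?_
  split_ifs with hx
  · refine Finset.sum_congr rfl fun g _ => ?_
    have : ∀ h, G.purePayoff σ p x (glue g h) = G.purePayoff σ p x g := fun h =>
      G.purePayoff_congr σ p x (by simp [glue, hx])
    simp only [this]
    rw [← Finset.sum_mul, ← Finset.mul_sum, stdSimplex.sum_eq_one, mul_one]
  · rw [Finset.sum_comm]
    refine Finset.sum_congr rfl fun h _ => ?_
    have : ∀ g, G.purePayoff σ p x (glue g h) = G.purePayoff σ p x h := fun g =>
      G.purePayoff_congr σ p x (by simp [glue, Function.update_of_ne hx])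
    simp only [this]
    rw [← Finset.sum_mul, ← Finset.sum_mul, stdSimplex.sum_eq_one, one_mul]

theorem payoff_congr (σ : G.Play) (p : P) {x y : W} (h : G.classOf p x = G.classOf p y) :
    G.payoff σ p x = G.payoff σ p y := by
  have hxy : (G.equiv p) x y := Quotient.exact h
  have : G.classFinset p x = G.classFinset p y := by
    ext z
    simp only [classFinset, Finset.mem_filter, Finset.mem_univ, true_and]
    exact ⟨fun hz => (G.equiv p).trans hz hxy, fun hz => (G.equiv p).trans hz ((G.equiv p).symm hxy)⟩
  simp only [payoff, this]

/-- A player who cannot increase the sum of her payoffs over all worlds cannot increase her payoff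
in any world. -/
theorem tolerates_of_forall_sum_payoff_le (p : P) (σ : G.Play)
    (h : ∀ t : G.MixedStrategy p,
      ∑ x, G.payoff (Function.update σ p t) p x ≤ ∑ x, G.payoff σ p x) : G.Tolerates p σ := by
  intro x t
  by_contra! hlt
  -- Following `t` only in the class of `x` keeps the gain there and changes no payoff elsewhere, so
  -- the sum strictly increases.
  obtain ⟨r, hr⟩ := G.exists_glued_strategy p (G.classOf p x) t (σ p)
  have hin : ∀ y, G.classOf p y = G.classOf p x →
      G.payoff (Function.update σ p r) p y = G.payoff (Function.update σ p t) p y := by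
    intro y hy
    refine Finset.inf'_congr _ rfl fun z hz => ?_
    rw [hr, if_pos ((G.classOf_eq_of_mem_classFinset hz).trans hy)]
  have hout : ∀ y, G.classOf p y ≠ G.classOf p x →
      G.payoff (Function.update σ p r) p y = G.payoff σ p y := by
    intro y hy
    refine Finset.inf'_congr _ rfl fun z hz => ?_
    have hz' := G.classOf_eq_of_mem_classFinset hz
    rw [hr, if_neg (hz' ▸ hy), Function.update_eq_self]
  refine absurd (h r) (not_le.2 (Finset.sum_lt_sum (fun y _ => ?_) ⟨x, Finset.mem_univ _, ?_⟩))
  · by_cases hy : G.classOf p y = G.classOf p x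
    · rw [hin y hy, G.payoff_congr _ p hy, G.payoff_congr _ p hy]
      exact hlt.le
    · exact (hout y hy).ge
  · rwa [hin x rfl]

/-- The extension of `KripkeGame.payoff` to arbitrary weights on the pure strategies. -/
noncomputable def minWeightedPayoff (σ : ∀ p, G.PureStrategy p → ℝ) (p : P) (x : W) : ℝ :=
  (G.classFinset p x).inf' (G.classFinset_nonempty p x) fun y => G.weightedPayoff σ p y

theorem payoff_eq_minWeightedPayoff (σ : G.Play) (p : P) (x : W) :
    G.payoff σ p x = G.minWeightedPayoff (fun q => (σ q : G.PureStrategy q → ℝ)) p x :=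
  rfl

theorem continuous_minWeightedPayoff (p : P) (x : W) :
    Continuous fun σ => G.minWeightedPayoff σ p x :=
  Continuous.finset_inf'_apply _ fun y _ => G.continuous_weightedPayoff p y

/-- Each expected payoff is linear in the player's own weights; the minimum keeps only concavity,
which is all that Ky Fan's inequality needs. -/
theorem concaveOn_minWeightedPayoff_update (σ : ∀ p, G.PureStrategy p → ℝ) (p : P) (x : W) :
    ConcaveOn ℝ Set.univ fun t : G.PureStrategy p → ℝ =>
      G.minWeightedPayoff (Function.update σ p t) p x := by
  refine ⟨convex_univ, fun t _ t' _ a b ha hb _ => Finset.le_inf' _ _ fun y hy => ?_⟩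
  rw [weightedPayoff_update_add_smul, smul_eq_mul, smul_eq_mul]
  gcongr <;> exact Finset.inf'_le _ hy

/-- The sum over all players and worlds of the payoffs that the players get by deviating, each one
alone, from `σ` to `τ`. -/
noncomputable def deviationPayoff (σ τ : ∀ p, G.PureStrategy p → ℝ) : ℝ :=
  ∑ p, ∑ x, G.minWeightedPayoff (Function.update σ p (τ p)) p x

theorem continuous_deviationPayoff :
    Continuous fun a : (∀ p, G.PureStrategy p → ℝ) × (∀ p, G.PureStrategy p → ℝ) =>
      G.deviationPayoff a.1 a.2 := by
  refine continuous_finsetSum _ fun p _ => continuous_finsetSum _ fun x _ => ?_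
  exact (G.continuous_minWeightedPayoff p x).comp
    (continuous_fst.update p ((continuous_apply p).comp continuous_snd))

theorem concaveOn_deviationPayoff (σ : ∀ p, G.PureStrategy p → ℝ) :
    ConcaveOn ℝ Set.univ (G.deviationPayoff σ) := by
  refine ⟨convex_univ, fun τ _ τ' _ a b ha hb hab => ?_⟩
  simp only [deviationPayoff, smul_eq_mul, Finset.mul_sum, ← Finset.sum_add_distrib]
  refine Finset.sum_le_sum fun p _ => Finset.sum_le_sum fun x _ => ?_
  exact (G.concaveOn_minWeightedPayoff_update σ p x).2 (Set.mem_univ (τ p)) (Set.mem_univ (τ' p))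
    ha hb hab

end KripkeGame

theorem mainTheorem2 {P : Type u} {W : Type v} [Fintype P] [DecidableEq P] [Fintype W]
    (G : KripkeGame.{u, v, w} P W) (hS : ∀ p, Nonempty (G.Strategy p)) :
    ∃ σ : G.Play, G.IsEquilibrium σ := by
  classical
  let K : Set (∀ p, G.PureStrategy p → ℝ) :=
    Set.univ.pi fun p => stdSimplex ℝ (G.PureStrategy p)
  have hne : K.Nonempty := by
    refine Set.univ_pi_nonempty_iff.2 fun p => ?_
    exact ⟨_, single_mem_stdSimplex ℝ (fun _ => Classical.arbitrary (G.Strategy p))⟩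
  have hcomp : IsCompact K := isCompact_univ_pi fun p => isCompact_stdSimplex ℝ _
  have hconv : Convex ℝ K := convex_pi fun p _ => convex_stdSimplex ℝ _
  obtain ⟨σ, hσ, hmax⟩ := exists_forall_le_diag hne hcomp hconv (φ := G.deviationPayoff)
    (fun τ _ => (G.continuous_deviationPayoff.comp
      (continuous_id.prodMk continuous_const)).continuousOn)
    (G.continuous_deviationPayoff.comp (continuous_id.prodMk continuous_id)).continuousOn
    fun σ _ => ((G.concaveOn_deviationPayoff σ).subset (Set.subset_univ K) hconv).quasiconcaveOn
  let ρ : G.Play := fun p => ⟨σ p, hσ p (Set.mem_univ p)⟩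
  refine ⟨ρ, fun p => G.tolerates_of_forall_sum_payoff_le p ρ fun t => ?_⟩
  -- Against a profile that differs from `σ` only at `p`, the terms of all other players agree on
  -- both sides and cancel.
  have h := hmax (Function.update σ p t) fun q _ => by
    by_cases hq : q = p
    · subst hq; rw [Function.update_self]; exact t.2
    · simpa [Function.update_of_ne hq] using hσ q (Set.mem_univ q)
  simp only [KripkeGame.deviationPayoff, Function.update_eq_self] at h
  rw [← Finset.add_sum_erase _ _ (Finset.mem_univ p),
    ← Finset.add_sum_erase _ _ (Finset.mem_univ p),
    Finset.sum_congr (s₁ := Finset.univ.erase p) rfl fun q hq => by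
      rw [Function.update_of_ne (Finset.ne_of_mem_erase hq), Function.update_eq_self],
    add_le_add_iff_right, Function.update_self] at h
  have hupd : (fun q => ((Function.update ρ p t) q : G.PureStrategy q → ℝ)) =
      Function.update σ p t := by
    funext q
    by_cases hq : q = p
    · subst hq; simp
    · rw [Function.update_of_ne hq, Function.update_of_ne hq]
      rfl
  have hρ : (fun q => (ρ q : G.PureStrategy q → ℝ)) = σ := rfl
  simpa only [KripkeGame.payoff_eq_minWeightedPayoff, hupd, hρ] using h
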